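/- Let $H$ be an infinite-dimensional real or complex Hilbert space, with inner product linear in the first argument, and let $(\Omega,\mu)$ be a measure space. A family $(x_t)_{t\in\Omega}\subseteq H$ is a \emph{continuous frame} of $H$ if for every $x\in H$ the function $\Theta x=(\langle x,x_t\rangle)_{t\in\Omega}$ belongs to $L_2(\Omega,\mu)$, and there are constants $B\ge A>0$ such that $$A\|x\|^2\le\int_\Omega|\langle x,x_t\rangle|^2\,d\mu(t)\le B\|x\|^2\qquad\text{for all }x\in H .$$ For $C>0$ the frame \emph{does $C$-stable phase retrieval near $x\in H$} if $$1\le\liminf_{y\to x}\; C\,\frac{\big\|\,|\Theta x|-|\Theta y|\,\big\|_{L_2(\Omega,\mu)}}{\min_{|\lambda|=1}\|x-\lambda y\|},$$ where $\lambda$ ranges over the unimodular scalars and $y$ over the vectors for which the denominator is nonzero. It \emph{does stable phase retrieval near $x$} if it does $C$-stable phase retrieval near $x$ for some $C>0$. \textbf{Theorem.} Let $(x_t)_{t\in\Omega}$ be a continuous frame of an infinite-dimensional Hilbert space $H$. Then there exists $x\in H$ such that $(x_t)_{t\in\Omega}$ does not do stable phase retrieval near $x$. Furthermore, the set of all $x\in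 H$ such that $(x_t)_{t\in\Omega}$ does not do stable phase retrieval near $x$ is dense in $H$. -/

import Mathlib

open MeasureTheory Filter Topology
open scoped ENNReal

/-- The analysis operator of a family `f = (f_t)` of vectors: `Θ x = (⟨x, f_t⟩)_t`, where
`⟨·, ·⟩` is linear in its first argument (Mathlib's `inner` is linear in its second one).
For a continuous frame every `Θ x` is in `L²(μ)`. -/
def analysisOp (𝕜 : Type*) {Ω H : Type*} [RCLike 𝕜] [NormedAddCommGroup H]
    [InnerProductSpace 𝕜 H] (f : Ω → H) (x : H) : Ω → 𝕜 :=
  fun t => inner 𝕜 (f t) x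

/-- `f = (f_t)` is a continuous frame over the measure space `(Ω, μ)`: the coefficient functions
`t ↦ ⟨x, f_t⟩` belong to `L²(μ)`, and there are constants `B ≥ A > 0` such that
`A ‖x‖² ≤ ∫ |⟨x, f_t⟩|² dμ(t) ≤ B ‖x‖²` for all `x`. -/
def IsContinuousFrame (𝕜 : Type*) {Ω H : Type*} [RCLike 𝕜] [MeasurableSpace Ω]
    [NormedAddCommGroup H] [InnerProductSpace 𝕜 H] (μ : Measure Ω) (f : Ω → H) : Prop :=
  (∀ x : H, MemLp (analysisOp 𝕜 f x) 2 μ) ∧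
    ∃ A B : ℝ, 0 < A ∧ A ≤ B ∧ ∀ x : H,
      A * ‖x‖ ^ 2 ≤ ∫ t, ‖analysisOp 𝕜 f x t‖ ^ 2 ∂μ ∧
        ∫ t, ‖analysisOp 𝕜 f x t‖ ^ 2 ∂μ ≤ B * ‖x‖ ^ 2

/-- The distance up to a unimodular scalar, `min_{|c| = 1} ‖x - c y‖`. -/
noncomputable def phaseDist (𝕜 : Type*) {H : Type*} [RCLike 𝕜] [NormedAddCommGroup H]
    [InnerProductSpace 𝕜 H] (x y : H) : ℝ :=
  ⨅ c : Metric.sphere (0 : 𝕜) 1, ‖x - (c : 𝕜) • y‖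

/-- The infimum in `phaseDist` is a minimum. -/
theorem phaseDist_isLeast (𝕜 : Type*) {H : Type*} [RCLike 𝕜] [NormedAddCommGroup H]
    [InnerProductSpace 𝕜 H] (x y : H) :
    IsLeast {r : ℝ | ∃ c : 𝕜, ‖c‖ = 1 ∧ r = ‖x - c • y‖} (phaseDist 𝕜 x y) := by
  have hb : BddBelow (Set.range fun c : Metric.sphere (0 : 𝕜) 1 => ‖x - (c : 𝕜) • y‖) :=
    ⟨0, by rintro _ ⟨c, rfl⟩; exact norm_nonneg _⟩
  constructor
  · have hc : IsCompact (Metric.sphere (0 : 𝕜) 1) := isCompact_sphere 0 1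
    obtain ⟨c, hc1, hc2⟩ := hc.exists_isMinOn (f := fun c : 𝕜 => ‖x - c • y‖)
      ⟨1, by simp⟩ (by fun_prop)
    have : Nonempty (Metric.sphere (0 : 𝕜) 1) := ⟨⟨c, hc1⟩⟩
    refine ⟨c, by simpa using hc1, le_antisymm (ciInf_le hb ⟨c, hc1⟩) ?_⟩
    exact le_ciInf fun d => hc2 d.2
  · rintro _ ⟨c, hc, rfl⟩
    exact ciInf_le hb ⟨c, by simpa using hc⟩

/-- The `L²(μ)` norm `‖ |Θ x| - |Θ y| ‖`. -/
noncomputable def phaselessDist (𝕜 : Type*) {Ω H : Type*} [RCLike 𝕜] [MeasurableSpace Ω]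
    [NormedAddCommGroup H] [InnerProductSpace 𝕜 H] (μ : Measure Ω) (f : Ω → H) (x y : H) : ℝ≥0∞ :=
  eLpNorm (fun t => ‖analysisOp 𝕜 f x t‖ - ‖analysisOp 𝕜 f y t‖) 2 μ

/-- `C`-stable phase retrieval near `x`:
`1 ≤ liminf_{y → x} C ‖ |Θ x| - |Θ y| ‖ / min_{|c| = 1} ‖x - c y‖`,
over those `y` for which the denominator is not zero. -/
def DoesStablePhaseRetrievalNearWith (𝕜 : Type*) {Ω H : Type*} [RCLike 𝕜] [MeasurableSpace Ω]
    [NormedAddCommGroup H] [InnerProductSpace 𝕜 H] (μ : Measure Ω) (f : Ω → H) (C : ℝ) (x : H) :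
    Prop :=
  1 ≤ liminf (fun y => ENNReal.ofReal C *
    (phaselessDist 𝕜 μ f x y / ENNReal.ofReal (phaseDist 𝕜 x y)))
    (𝓝[{y : H | phaseDist 𝕜 x y ≠ 0}] x)

/-- Stable phase retrieval near `x`: `C`-stable phase retrieval near `x` for some `C > 0`. -/
def DoesStablePhaseRetrievalNear (𝕜 : Type*) {Ω H : Type*} [RCLike 𝕜] [MeasurableSpace Ω]
    [NormedAddCommGroup H] [InnerProductSpace 𝕜 H] (μ : Measure Ω) (f : Ω → H) (x : H) : Prop :=
  ∃ C : ℝ, 0 < C ∧ DoesStablePhaseRetrievalNearWith 𝕜 μ f C x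

/-! For `u ≠ 0` and an orthonormal sequence `e n` orthogonal to `u`, compare `u + δ e n` with `u - δ
e n`. The coefficients of `e n` tend to 0 pointwise, so by dominated convergence the moduli become
indistinguishable in `L²`, while the distance modulo phase stays at least `min ‖u‖ δ`. Hence every
constant `C` fails at points arbitrarily close to `u`, but these points depend on `C` and on the
scale `ε`. Failure at a fixed `C` and `ε` is an open condition, so Baire's theorem yields a dense
set of points where all constants fail at all scales. -/

/-- In an infinite-dimensional Hilbert space every vector is orthogonal to some
orthonormal sequence. -/
theorem exists_orthonormal_seq_orthogonal {𝕜 H : Type*} [RCLike 𝕜] [NormedAddCommGroup H]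
    [InnerProductSpace 𝕜 H] [CompleteSpace H] (hH : ¬ FiniteDimensional 𝕜 H) (x : H) :
    ∃ e : ℕ → H, Orthonormal 𝕜 e ∧ ∀ n, inner 𝕜 x (e n) = 0 := by
  obtain ⟨w, b, -⟩ := exists_hilbertBasis 𝕜 (𝕜 ∙ x)ᗮ
  have hw : Infinite w := by
    by_contra hfin
    rw [not_infinite_iff_finite] at hfin
    have := Fintype.ofFinite w
    have hK : FiniteDimensional 𝕜 (𝕜 ∙ x)ᗮ :=
      b.toOrthonormalBasis.toBasis.finiteDimensional_of_finite
    apply hH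
    have hsup : FiniteDimensional 𝕜 ((𝕜 ∙ x) ⊔ (𝕜 ∙ x)ᗮ : Submodule 𝕜 H) := inferInstance
    rw [Submodule.sup_orthogonal_of_hasOrthogonalProjection] at hsup
    exact Module.finite_def.2 (Module.Finite.iff_fg.1 hsup)
  let i := Infinite.natEmbedding w
  refine ⟨fun n => (b (i n) : H), ?_, fun n => ?_⟩
  · exact (b.orthonormal.comp i i.injective).comp_linearIsometry (𝕜 ∙ x)ᗮ.subtypeₗᵢ
  · exact Submodule.mem_orthogonal_singleton_iff_inner_right.1 (b (i n)).2

/-- An orthonormal sequence is weakly null. -/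
theorem Orthonormal.tendsto_inner_zero {𝕜 H : Type*} [RCLike 𝕜] [NormedAddCommGroup H]
    [InnerProductSpace 𝕜 H] {e : ℕ → H} (he : Orthonormal 𝕜 e) (z : H) :
    Tendsto (fun n => inner 𝕜 z (e n)) atTop (𝓝 0) := by
  have h := (he.inner_products_summable (x := z)).tendsto_atTop_zero
  rw [tendsto_zero_iff_norm_tendsto_zero]
  have h2 := (Real.continuous_sqrt.tendsto 0).comp h
  simpa [Function.comp_def, norm_inner_symm z] using h2

theorem analysisOp_add {𝕜 Ω H : Type*} [RCLike 𝕜] [NormedAddCommGroup H]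
    [InnerProductSpace 𝕜 H] {f : Ω → H} (x y : H) (t : Ω) :
    analysisOp 𝕜 f (x + y) t = analysisOp 𝕜 f x t + analysisOp 𝕜 f y t :=
  inner_add_right _ _ _

theorem analysisOp_sub {𝕜 Ω H : Type*} [RCLike 𝕜] [NormedAddCommGroup H]
    [InnerProductSpace 𝕜 H] {f : Ω → H} (x y : H) (t : Ω) :
    analysisOp 𝕜 f (x - y) t = analysisOp 𝕜 f x t - analysisOp 𝕜 f y t :=
  inner_sub_right _ _ _

section

variable {𝕜 Ω H : Type*} [RCLike 𝕜] [MeasurableSpace Ω] [NormedAddCommGroup H]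
  [InnerProductSpace 𝕜 H] {μ : Measure Ω} {f : Ω → H}

theorem IsContinuousFrame.exists_eLpNorm_le (hf : IsContinuousFrame 𝕜 μ f) :
    ∃ K : ℝ, 0 ≤ K ∧ ∀ x : H, eLpNorm (analysisOp 𝕜 f x) 2 μ ≤ ENNReal.ofReal (K * ‖x‖) := by
  obtain ⟨hL, A, B, hA, hAB, h⟩ := hf
  refine ⟨√B, Real.sqrt_nonneg _, fun x => ?_⟩
  rw [(hL x).eLpNorm_eq_integral_rpow_norm two_ne_zero ENNReal.ofNat_ne_top]
  refine ENNReal.ofReal_le_ofReal ?_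
  have h2 := Real.sqrt_le_sqrt (h x).2
  rw [Real.sqrt_mul (hA.le.trans hAB), Real.sqrt_sq (norm_nonneg _)] at h2
  simpa [Real.sqrt_eq_rpow] using h2

/-- The reverse triangle inequality and the upper frame bound make it Lipschitz. This serves the
openness needed for Baire. -/
theorem IsContinuousFrame.continuous_phaselessDist (hf : IsContinuousFrame 𝕜 μ f) (y : H) :
    Continuous fun x => phaselessDist 𝕜 μ f x y := by
  obtain ⟨K, hK, h⟩ := hf.exists_eLpNorm_le
  refine continuous_of_le_add_edist (ENNReal.ofReal K) ENNReal.ofReal_ne_top fun x x' => ?_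
  calc phaselessDist 𝕜 μ f x y
      = eLpNorm ((fun t => ‖analysisOp 𝕜 f x' t‖ - ‖analysisOp 𝕜 f y t‖) +
          fun t => ‖analysisOp 𝕜 f x t‖ - ‖analysisOp 𝕜 f x' t‖) 2 μ := by
        unfold phaselessDist
        congr 1
        ext t
        simp
    _ ≤ phaselessDist 𝕜 μ f x' y +
          eLpNorm (fun t => ‖analysisOp 𝕜 f x t‖ - ‖analysisOp 𝕜 f x' t‖) 2 μ :=
        eLpNorm_add_le ((hf.1 x').1.norm.sub (hf.1 y).1.norm)
          ((hf.1 x).1.norm.sub (hf.1 x').1.norm) one_le_two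
    _ ≤ phaselessDist 𝕜 μ f x' y + eLpNorm (analysisOp 𝕜 f (x - x')) 2 μ := by
        gcongr
        refine eLpNorm_mono fun t => ?_
        rw [analysisOp_sub]
        exact abs_norm_sub_norm_le _ _
    _ ≤ phaselessDist 𝕜 μ f x' y + ENNReal.ofReal K * edist x x' := by
        gcongr
        rw [edist_dist, dist_eq_norm, ← ENNReal.ofReal_mul hK]
        exact h _

theorem continuous_phaseDist (y : H) : Continuous fun x => phaseDist 𝕜 x y := by
  refine (LipschitzWith.of_le_add fun x x' => ?_ :
    LipschitzWith 1 fun x => phaseDist 𝕜 x y).continuous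
  obtain ⟨c, hc, h⟩ := (phaseDist_isLeast 𝕜 x' y).1
  rw [h, dist_eq_norm]
  refine ((phaseDist_isLeast 𝕜 x y).2 ⟨c, hc, rfl⟩).trans ?_
  calc ‖x - c • y‖ = ‖(x' - c • y) + (x - x')‖ := by congr 1; abel
    _ ≤ _ := norm_add_le _ _

/-- For orthogonal `u`, `v` the vectors `u + v` and `u - v` stay apart modulo phase. -/
theorem le_phaseDist_add_sub {u v : H} (h : inner 𝕜 u v = 0) :
    min ‖u‖ ‖v‖ ≤ phaseDist 𝕜 (u + v) (u - v) := by
  obtain ⟨c, hc, hd⟩ := (phaseDist_isLeast 𝕜 (u + v) (u - v)).1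
  -- One of the two coefficients `1 - c`, `1 + c` thus has modulus at least 1.
  have hsum : 2 ≤ ‖1 - c‖ + ‖1 + c‖ := by
    have := norm_add_le (1 - c) (1 + c)
    have h2 : (1 - c) + (1 + c) = 2 := by ring
    rw [h2] at this
    simpa using this
  have heq : u + v - c • (u - v) = (1 - c) • u + (1 + c) • v := by module
  have hpyth := norm_add_sq_eq_norm_sq_add_norm_sq_of_inner_eq_zero ((1 - c) • u) ((1 + c) • v)
    (𝕜 := 𝕜) (by rw [inner_smul_left, inner_smul_right, h]; simp)
  rw [hd, heq]
  rcases le_total 1 ‖1 - c‖ with h1 | h1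
  · refine (min_le_left _ _).trans (abs_le_of_sq_le_sq' ?_ (norm_nonneg _)).2
    have : ‖u‖ ≤ ‖(1 - c) • u‖ := by
      rw [norm_smul]; exact le_mul_of_one_le_left (norm_nonneg _) h1
    nlinarith [norm_nonneg u, mul_self_nonneg ‖(1 + c) • v‖]
  · refine (min_le_right _ _).trans (abs_le_of_sq_le_sq' ?_ (norm_nonneg _)).2
    have : ‖v‖ ≤ ‖(1 + c) • v‖ := by
      rw [norm_smul]; exact le_mul_of_one_le_left (norm_nonneg _) (by linarith)
    nlinarith [norm_nonneg v, mul_self_nonneg ‖(1 - c) • u‖]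

/-- Weakly null perturbations in opposite directions become indistinguishable in modulus: the
analysis operator turns weak convergence into pointwise convergence. -/
theorem IsContinuousFrame.tendsto_phaselessDist (hf : IsContinuousFrame 𝕜 μ f) (u : H)
    {v : ℕ → H} (hv : ∀ z : H, Tendsto (fun n => inner 𝕜 z (v n)) atTop (𝓝 0)) :
    Tendsto (fun n => phaselessDist 𝕜 μ f (u + v n) (u - v n)) atTop (𝓝 0) := by
  -- From `||a + b| - |a - b|| ≤ 2|a|`: an `L²` majorant independent of `n`.
  have hb : ∀ n t, ‖‖analysisOp 𝕜 f (u + v n) t‖ - ‖analysisOp 𝕜 f (u - v n) t‖‖ ≤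
      ‖2 * ‖analysisOp 𝕜 f u t‖‖ := fun n t => by
    have h := abs_norm_sub_norm_le (analysisOp 𝕜 f u t + analysisOp 𝕜 f (v n) t)
      (-(analysisOp 𝕜 f u t - analysisOp 𝕜 f (v n) t))
    rw [norm_neg, sub_neg_eq_add, add_add_sub_cancel, ← two_mul, norm_mul, RCLike.norm_two] at h
    rw [analysisOp_add, analysisOp_sub, Real.norm_eq_abs, norm_mul, norm_norm, Real.norm_two]
    exact h
  have hlim : ∀ t, Tendsto (fun n => ‖analysisOp 𝕜 f (u + v n) t‖ -
      ‖analysisOp 𝕜 f (u - v n) t‖) atTop (𝓝 0) := fun t => by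
    have h0 : Tendsto (fun n => analysisOp 𝕜 f (v n) t) atTop (𝓝 0) := hv (f t)
    have h1 := ((tendsto_const_nhds (x := analysisOp 𝕜 f u t)).add h0).norm.sub
      ((tendsto_const_nhds (x := analysisOp 𝕜 f u t)).sub h0).norm
    simpa [analysisOp_add, analysisOp_sub] using h1
  have hint : Tendsto (fun n => ∫⁻ t, ‖‖analysisOp 𝕜 f (u + v n) t‖ -
      ‖analysisOp 𝕜 f (u - v n) t‖‖ₑ ^ (2 : ℝ) ∂μ) atTop (𝓝 (∫⁻ _, 0 ∂μ)) := by
    refine tendsto_lintegral_of_dominated_convergence'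
      (fun t => ‖2 * ‖analysisOp 𝕜 f u t‖‖ₑ ^ (2 : ℝ)) (fun n => ?_) (fun n => ?_) ?_ ?_
    · exact ((hf.1 _).1.norm.sub (hf.1 _).1.norm).enorm.pow_const _
    · refine Eventually.of_forall fun t => ?_
      have h := hb n t
      dsimp only
      gcongr
      exact enorm_le_iff_norm_le.2 h
    · have h := ((hf.1 u).norm.const_mul 2).2
      have h2 := (eLpNorm_lt_top_iff_lintegral_rpow_enorm_lt_top two_ne_zero
        ENNReal.ofNat_ne_top).1 h
      simpa using h2.ne
    · refine Eventually.of_forall fun t => ?_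
      have h := ((hlim t).enorm).ennrpow_const 2
      simpa using h
  have h := hint.ennrpow_const (1 / 2)
  simp only [phaselessDist, eLpNorm_eq_lintegral_rpow_enorm_toReal two_ne_zero
    ENNReal.ofNat_ne_top]
  simpa using h

/-- The points admitting, within distance `ε`, a vector witnessing that the constant `C` does not
suffice for stability. -/
def instabilitySet (𝕜 : Type*) {Ω H : Type*} [RCLike 𝕜] [MeasurableSpace Ω]
    [NormedAddCommGroup H] [InnerProductSpace 𝕜 H] (μ : Measure Ω) (f : Ω → H) (C ε : ℝ) :
    Set H :=
  {x | ∃ y, dist x y < ε ∧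
    ENNReal.ofReal C * phaselessDist 𝕜 μ f x y < ENNReal.ofReal (phaseDist 𝕜 x y)}

theorem IsContinuousFrame.isOpen_instabilitySet (hf : IsContinuousFrame 𝕜 μ f) (C ε : ℝ) :
    IsOpen (instabilitySet 𝕜 μ f C ε) := by
  simp only [instabilitySet, Set.ofPred_exists, Set.ofPred_and]
  refine isOpen_iUnion fun y => IsOpen.inter ?_ ?_
  · exact isOpen_lt (by fun_prop) continuous_const
  · exact isOpen_lt
      ((ENNReal.continuous_const_mul ENNReal.ofReal_ne_top).comp (hf.continuous_phaselessDist y))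
      (ENNReal.continuous_ofReal.comp (continuous_phaseDist y))

theorem IsContinuousFrame.dense_instabilitySet [CompleteSpace H]
    (hH : ¬ FiniteDimensional 𝕜 H) (hf : IsContinuousFrame 𝕜 μ f) (C : ℝ) {ε : ℝ} (hε : 0 < ε) :
    Dense (instabilitySet 𝕜 μ f C ε) := by
  have hnt : Nontrivial H := by
    by_contra h
    rw [not_nontrivial_iff_subsingleton] at h
    exact hH inferInstance
  have := Module.punctured_nhds_neBot 𝕜 H (0 : H)
  -- Only `u ≠ 0` is approximated, since the lower bound `min ‖u‖ δ` must be positive.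
  refine dense_closure.1 ((dense_compl_singleton (0 : H)).mono fun u hu => ?_)
  rw [Metric.mem_closure_iff]
  intro r hr
  obtain ⟨e, he, hue⟩ := exists_orthonormal_seq_orthogonal hH u
  -- `r / 2` keeps `u + δ e n` within `r` of `u`; `ε / 4` keeps the pair, at distance at most `2δ`,
  -- within `ε`.
  set δ := min (r / 2) (ε / 4) with hδ
  have hδ0 : 0 < δ := by positivity
  have hnorm : ∀ n, ‖(δ : 𝕜) • e n‖ = δ := fun n => by
    rw [norm_smul, he.1 n, mul_one, RCLike.norm_ofReal, abs_of_pos hδ0]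
  have hweak : ∀ z : H, Tendsto (fun n => inner 𝕜 z ((δ : 𝕜) • e n)) atTop (𝓝 0) := fun z => by
    simpa [inner_smul_right] using (he.tendsto_inner_zero z).const_mul (δ : 𝕜)
  have hlim := ENNReal.Tendsto.const_mul (a := ENNReal.ofReal C)
    (hf.tendsto_phaselessDist u hweak) (Or.inr ENNReal.ofReal_ne_top)
  rw [mul_zero] at hlim
  have hpos : 0 < ENNReal.ofReal (min ‖u‖ δ) :=
    ENNReal.ofReal_pos.2 (lt_min (norm_pos_iff.2 hu) hδ0)
  obtain ⟨n, hn⟩ := (hlim.eventually_lt_const hpos).exists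
  refine ⟨u + (δ : 𝕜) • e n, ⟨u - (δ : 𝕜) • e n, ?_, hn.trans_le ?_⟩, ?_⟩
  · rw [dist_eq_norm, add_sub_sub_cancel]
    refine (norm_add_le _ _).trans_lt ?_
    rw [hnorm]
    linarith [min_le_right (r / 2) (ε / 4)]
  · refine ENNReal.ofReal_le_ofReal ?_
    have h := le_phaseDist_add_sub (𝕜 := 𝕜) (u := u) (v := (δ : 𝕜) • e n)
      (by rw [inner_smul_right, hue, mul_zero])
    rwa [hnorm] at h
  · rw [dist_self_add_right, hnorm]
    linarith [min_le_left (r / 2) (ε / 4)]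

theorem not_doesStablePhaseRetrievalNear_of_forall_mem {x : H}
    (hx : ∀ n : ℕ, x ∈ instabilitySet 𝕜 μ f n (1 / ((n : ℝ) + 1))) :
    ¬ DoesStablePhaseRetrievalNear 𝕜 μ f x := by
  rintro ⟨C, hC, h⟩
  have hfreq : ∃ᶠ y in 𝓝[{y : H | phaseDist 𝕜 x y ≠ 0}] x, ENNReal.ofReal C *
      (phaselessDist 𝕜 μ f x y / ENNReal.ofReal (phaseDist 𝕜 x y)) ≤ 1 / 2 := by
    rw [frequently_nhdsWithin_iff, Metric.nhds_basis_ball.frequently_iff]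
    intro r hr
    obtain ⟨k, hk⟩ := exists_nat_one_div_lt hr
    -- The factor 2 pushes the quotient down to `1 / 2`, strictly below the threshold 1.
    obtain ⟨m, hm⟩ := exists_nat_ge (2 * C)
    obtain ⟨y, hy, hlt⟩ := hx (max k m)
    have hpos : 0 < phaseDist 𝕜 x y := ENNReal.ofReal_pos.1 (zero_le.trans_lt hlt)
    refine ⟨y, ?_, ?_, hpos.ne'⟩
    · rw [Metric.mem_ball, dist_comm]
      refine (hy.trans_le ?_).trans hk
      gcongr
      exact le_max_left _ _
    · rw [← mul_div_assoc]
      refine ENNReal.div_le_of_le_mul ?_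
      rw [one_div, ← ENNReal.div_eq_inv_mul, ENNReal.le_div_iff_mul_le (by simp) (by simp)]
      refine le_trans ?_ hlt.le
      rw [mul_right_comm]
      gcongr
      rw [← ENNReal.ofReal_ofNat, ← ENNReal.ofReal_mul hC.le]
      refine ENNReal.ofReal_le_ofReal ?_
      have : (m : ℝ) ≤ (max k m : ℕ) := by exact_mod_cast le_max_right k m
      linarith
  have h2 := h.trans (liminf_le_of_frequently_le' hfreq)
  rw [one_div, ENNReal.one_le_inv] at h2
  norm_num at h2

end

theorem mainTheorem1 {𝕜 Ω H : Type*} [RCLike 𝕜] [MeasurableSpace Ω]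
    [NormedAddCommGroup H] [InnerProductSpace 𝕜 H] [CompleteSpace H]
    (hH : ¬ FiniteDimensional 𝕜 H) (μ : Measure Ω) (f : Ω → H)
    (hf : IsContinuousFrame 𝕜 μ f) :
    (∃ x : H, ¬ DoesStablePhaseRetrievalNear 𝕜 μ f x) ∧
      Dense {x : H | ¬ DoesStablePhaseRetrievalNear 𝕜 μ f x} := by
  have hd : Dense {x : H | ¬ DoesStablePhaseRetrievalNear 𝕜 μ f x} :=
    (dense_iInter_of_isOpen_nat
      (fun n : ℕ => hf.isOpen_instabilitySet (n : ℝ) (1 / ((n : ℝ) + 1)))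
      (fun n => hf.dense_instabilitySet hH (n : ℝ) Nat.one_div_pos_of_nat)).mono
      fun _ hx => not_doesStablePhaseRetrievalNear_of_forall_mem (Set.mem_iInter.1 hx)
  exact ⟨hd.nonempty, hd⟩
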